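/- Let $d\ge 0$ be an integer. Two orthonormal bases $(\mathbf e_1,\dots,\mathbf e_d)$ and $(\mathbf f_1,\dots,\mathbf f_d)$ of $\mathbb C^d$ are called mutually unbiased if $|\langle \mathbf e_k,\mathbf f_j\rangle| = 1/\sqrt d$ for all $k,j$. A finite family of orthonormal bases of $\mathbb C^d$ is called a collection of MUB if any two of its members (with different indices) are mutually unbiased, and a complete collection if moreover it has exactly $d+1$ members. Let $N(d)\in\{0,1,2,\dots\}\cup\{\infty\}$ be the supremum of the numbers of members of collections of MUB in $\mathbb C^d$. Equip $M_d(\mathbb C)$ with the Hilbert-Schmidt scalar product $\langle A,B\rangle=\mathrm{Tr}(A^*B)$; orthogonal complements in $M_d(\mathbb C)$ refer to it. A MASA is a maximal abelian $*$-subalgebra of $M_d(\mathbb C)$. (a) Let $\mathcal E_1,\dots,\mathcal E_d$ be a collection of $d$ MUB in $\mathbb C^d$. For each $k$ let $\mathcal A_k\subset M_d(\mathbb C)$ be the linear span of the orthogonal projections onto the lines spanned by the vectors of $\mathcal E_k$, and let $V=\sum_{k=1}^d\big(\mathcal A_k\cap\{\mathbb 1\}^\perp\big)$. Then $V^\perp$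 is a MASA, and there exists an orthonormal basis $\mathcal E_{d+1}$ of $\mathbb C^d$ such that $\mathcal E_1,\dots,\mathcal E_d,\mathcal E_{d+1}$ is a complete collection of MUB. (b) $N(d)\ne d$. (c) If $d>1$, then either $N(d)=d+1$ or $N(d)\le d-1$. -/

import Mathlib

namespace MUB

/-- Orthonormal bases (indexed by `Fin d`) of the Hilbert space `ℂ^d`. -/
abbrev ONB (d : ℕ) := OrthonormalBasis (Fin d) ℂ (EuclideanSpace ℂ (Fin d))

/-- Two orthonormal bases of `ℂ^d` are mutually unbiased if `|⟨e_k, f_j⟩| = 1 / √d` for all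
`k, j`. -/
def MutuallyUnbiased {d : ℕ} (E F : ONB d) : Prop :=
  ∀ k j : Fin d, ‖inner ℂ (E k) (F j)‖ = 1 / Real.sqrt d

/-- A collection of `n` pairwise mutually unbiased orthonormal bases of `ℂ^d`. -/
def IsMUB {d n : ℕ} (E : Fin n → ONB d) : Prop :=
  Pairwise fun a b => MutuallyUnbiased (E a) (E b)

/-- A complete collection of mutually unbiased bases in `ℂ^d`: one that consists of
`d + 1` bases. -/
def IsCompleteMUB {d n : ℕ} (E : Fin n → ONB d) : Prop :=
  n = d + 1 ∧ IsMUB E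

/-- `N(d)`, the maximum number of bases in a collection of mutually unbiased bases of `ℂ^d`,
as an element of `ℕ∞` (it is `⊤` if there are arbitrarily large such collections, which
happens for `d ≤ 1`). -/
noncomputable def maxMUB (d : ℕ) : ℕ∞ :=
  ⨆ n ∈ {n : ℕ | ∃ E : Fin n → ONB d, IsMUB E}, (n : ℕ∞)

/-- The matrix `e_j e_j^*` of the orthogonal projection of `ℂ^d` onto the line `ℂ e_j`. -/
noncomputable def proj {d : ℕ} (E : ONB d) (j : Fin d) : Matrix (Fin d) (Fin d) ℂ :=
  Matrix.vecMulVec (E j).ofLp (star (E j).ofLp)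

/-- The subspace of `M_d(ℂ)` spanned by the orthogonal projections onto the lines `ℂ e_j`. -/
noncomputable def basisAlgebra {d : ℕ} (E : ONB d) :
    Submodule ℂ (Matrix (Fin d) (Fin d) ℂ) :=
  Submodule.span ℂ (Set.range (proj E))

/-- The orthogonal complement of a set of matrices for the Hilbert-Schmidt scalar product
`⟨A, B⟩ = Tr (A^* B)`. -/
def hsOrthogonal {d : ℕ} (S : Set (Matrix (Fin d) (Fin d) ℂ)) :
    Submodule ℂ (Matrix (Fin d) (Fin d) ℂ) where
  carrier := {X | ∀ A ∈ S, (A.conjTranspose * X).trace = 0}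
  zero_mem' := by intro A _; simp
  add_mem' := by
    intro X Y hX hY A hA
    rw [Matrix.mul_add, Matrix.trace_add, hX A hA, hY A hA, add_zero]
  smul_mem' := by
    intro c X hX A hA
    rw [Matrix.mul_smul, Matrix.trace_smul, hX A hA, smul_zero]

/-- The sum of the subspaces `A_k ∩ {1}^⊥`, where `A_k` is the span of the projections of the
`k`-th basis. -/
noncomputable def tracelessSum {d n : ℕ} (E : Fin n → ONB d) :
    Submodule ℂ (Matrix (Fin d) (Fin d) ℂ) :=
  ⨆ k : Fin n, basisAlgebra (E k) ⊓ hsOrthogonal {1}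

/-- A linear subspace of `M_d(ℂ)` is a MASA if it is (the underlying subspace of) a
maximal abelian `*`-subalgebra. Mathlib's `StarSubalgebra` contains `1`; every maximal abelian
`*`-subalgebra of `M_d(ℂ)` does, so requiring it changes nothing. -/
def IsMASA {d : ℕ} (B : Submodule ℂ (Matrix (Fin d) (Fin d) ℂ)) : Prop :=
  ∃ A : StarSubalgebra ℂ (Matrix (Fin d) (Fin d) ℂ),
    Subalgebra.toSubmodule A.toSubalgebra = B ∧
    Maximal (fun C : StarSubalgebra ℂ (Matrix (Fin d) (Fin d) ℂ) =>
      ∀ x ∈ C, ∀ y ∈ C, x * y = y * x) A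

end MUB

namespace MUB

open Matrix

variable {d n : ℕ}

/-! ### Rank one projections of orthonormal bases -/

/-! For `d` unbiased bases, the orthogonal projection R onto V^⊥ is X ↦ X + Tr(X) 1 - ∑ Tr(PX) P
(`residual`). Its kernel is unchanged when the two middle indices are exchanged
(`residualKernel_swap_snd`), so its Choi matrix is its own matrix. As R = R R^*, R is completely
positive with Kraus operators R(E_pq), which span V^⊥ (`residual_kraus`).

R is unital and trace preserving, so its fixed points, the elements of V^⊥, commute with the Kraus
operators; conversely, a matrix commuting with these is fixed. So V^⊥ is its own commutant, that is,
a MASA. The projections of a common eigenbasis lie in V^⊥, which says that this basis is unbiased to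
the given ones. Two further unbiased bases would have commuting projections, which forces `d = 1`.
-/

lemma proj_apply (E : ONB d) (j a b : Fin d) :
    proj E j a b = (E j).ofLp a * star ((E j).ofLp b) := rfl

lemma conjTranspose_proj (E : ONB d) (j : Fin d) : (proj E j)ᴴ = proj E j := by
  rw [proj, conjTranspose_vecMulVec, star_star]

lemma inner_eq_star_dotProduct (x y : EuclideanSpace ℂ (Fin d)) :
    inner ℂ x y = star x.ofLp ⬝ᵥ y.ofLp := by
  rw [EuclideanSpace.inner_eq_star_dotProduct, dotProduct_comm]

lemma trace_proj (E : ONB d) (j : Fin d) : (proj E j).trace = 1 := by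
  rw [proj, trace_vecMulVec, dotProduct_comm, ← inner_eq_star_dotProduct]
  simp

lemma proj_mul_proj (E F : ONB d) (j l : Fin d) :
    proj E j * proj F l =
      inner ℂ (E j) (F l) • vecMulVec (E j).ofLp (star (F l).ofLp) := by
  rw [proj, proj, vecMulVec_mul_vecMulVec, inner_eq_star_dotProduct, vecMulVec_smul]

lemma trace_proj_mul_proj (E F : ONB d) (j l : Fin d) :
    (proj E j * proj F l).trace = ((‖inner ℂ (E j) (F l)‖ ^ 2 : ℝ) : ℂ) := by
  rw [proj_mul_proj, trace_smul, trace_vecMulVec, dotProduct_comm, ← inner_eq_star_dotProduct,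
    smul_eq_mul, ← inner_conj_symm (F l) (E j), Complex.mul_conj']
  norm_cast

lemma trace_proj_mul_proj_self (E : ONB d) (j l : Fin d) :
    (proj E j * proj E l).trace = if j = l then 1 else 0 := by
  rw [trace_proj_mul_proj, OrthonormalBasis.inner_eq_ite]
  split_ifs <;> simp

lemma sum_proj (E : ONB d) : ∑ j, proj E j = 1 := by
  ext a b
  have h := E.sum_inner_mul_inner (EuclideanSpace.single a 1) (EuclideanSpace.single b 1)
  simp only [EuclideanSpace.inner_single_left, EuclideanSpace.inner_single_right] at h
  simp only [Matrix.sum_apply, proj_apply]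
  simpa [Matrix.one_apply, eq_comm] using h

lemma one_mem_basisAlgebra (E : ONB d) : 1 ∈ basisAlgebra E := by
  rw [← sum_proj E]
  exact Submodule.sum_mem _ fun j _ => Submodule.subset_span ⟨j, rfl⟩

lemma sum_trace_proj_mul (E : ONB d) (X : Matrix (Fin d) (Fin d) ℂ) :
    ∑ j, (proj E j * X).trace = X.trace := by
  rw [← trace_sum, ← Finset.sum_mul, sum_proj, one_mul]

lemma MutuallyUnbiased.trace {E F : ONB d} (h : MutuallyUnbiased E F) (j l : Fin d) :
    (proj E j * proj F l).trace = (d : ℂ)⁻¹ := by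
  rw [trace_proj_mul_proj, h, div_pow, Real.sq_sqrt (Nat.cast_nonneg d)]
  simp

lemma mutuallyUnbiased_of_trace {E F : ONB d}
    (h : ∀ j l, (proj E j * proj F l).trace = (d : ℂ)⁻¹) : MutuallyUnbiased E F := by
  intro j l
  have h2 := h j l
  rw [trace_proj_mul_proj] at h2
  have h3 : ‖inner ℂ (E j) (F l)‖ ^ 2 = (d : ℝ)⁻¹ :=
    Complex.ofReal_injective (by rw [h2]; simp)
  rw [← Real.sqrt_sq (norm_nonneg (inner ℂ (E j) (F l))), h3, Real.sqrt_inv, one_div]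

lemma MutuallyUnbiased.symm {E F : ONB d} (h : MutuallyUnbiased E F) : MutuallyUnbiased F E :=
  fun k j => by rw [norm_inner_symm]; exact h j k

/-- Two mutually unbiased bases with a commuting pair of projections exist in dimension one only. -/
lemma MutuallyUnbiased.eq_one_of_commute {E F : ONB d} (h : MutuallyUnbiased E F) (j l : Fin d)
    (hc : proj E j * proj F l = proj F l * proj E j) : d = 1 := by
  have idem : ∀ (G : ONB d) i, proj G i * proj G i = proj G i := by
    intro G i
    rw [proj_mul_proj, OrthonormalBasis.inner_eq_one, one_smul, proj]
  -- With P, Q the two projections, PQP = P/d. Commutation gives PQ = P/d, hence PQ = PQQ = PQ/d,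
  -- and Tr(PQ) ≠ 0.
  have key : proj E j * proj F l * proj E j = (d : ℂ)⁻¹ • proj E j := by
    rw [proj_mul_proj, proj, smul_mul_assoc, vecMulVec_mul_vecMulVec, ← inner_eq_star_dotProduct,
      vecMulVec_smul, smul_smul, ← h.trace j l, trace_proj_mul_proj,
      ← inner_conj_symm (F l) (E j), Complex.mul_conj']
    norm_cast
  have h1 : proj E j * proj F l = (d : ℂ)⁻¹ • proj E j := by
    rw [← key, mul_assoc, ← hc, ← mul_assoc, idem]
  have h2 : (d : ℂ)⁻¹ • (proj E j * proj F l) = proj E j * proj F l := by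
    conv_rhs => rw [← idem F l, ← mul_assoc, h1, smul_mul_assoc]
  have h3 := congrArg Matrix.trace h2
  have hd : (d : ℂ) ≠ 0 := by exact_mod_cast j.pos.ne'
  rw [trace_smul, h.trace, smul_eq_mul] at h3
  field_simp at h3
  exact_mod_cast h3.symm

/-! ### The orthogonal complement of the traceless parts -/

lemma trace_conjTranspose_mul_eq_zero_comm (A X : Matrix (Fin d) (Fin d) ℂ) :
    (Aᴴ * X).trace = 0 ↔ (Xᴴ * A).trace = 0 := by
  rw [← star_eq_zero, ← trace_conjTranspose, conjTranspose_mul, conjTranspose_conjTranspose]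

/-- The complement consists of the matrices all of whose expectations in the vectors of the bases
agree with the normalised trace. -/
lemma mem_hsOrthogonal_tracelessSum (E : Fin n → ONB d) (X : Matrix (Fin d) (Fin d) ℂ) :
    X ∈ hsOrthogonal (tracelessSum E : Set (Matrix (Fin d) (Fin d) ℂ)) ↔
      ∀ k j, (proj (E k) j * X).trace = (d : ℂ)⁻¹ * X.trace := by
  constructor
  · intro hX k j
    have hd : (d : ℂ) ≠ 0 := by exact_mod_cast j.pos.ne'
    have hmem : proj (E k) j - (d : ℂ)⁻¹ • 1 ∈ tracelessSum E := by
      refine Submodule.mem_iSup_of_mem k ⟨?_, ?_⟩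
      · exact Submodule.sub_mem _ (Submodule.subset_span ⟨j, rfl⟩)
          (Submodule.smul_mem _ _ (one_mem_basisAlgebra _))
      · rintro _ rfl
        simp [trace_sub, trace_proj, hd]
    have h := hX _ hmem
    rw [conjTranspose_sub, conjTranspose_proj, conjTranspose_smul, conjTranspose_one, sub_mul,
      trace_sub, smul_mul_assoc, one_mul, trace_smul, smul_eq_mul, sub_eq_zero] at h
    simpa using h
  · intro hX A hA
    -- Read as an inclusion of subspaces, orthogonality need only be tested on each summand.
    have hle : tracelessSum E ≤ hsOrthogonal {X} := by
      refine iSup_le fun k => ?_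
      rintro B ⟨hB, hB0⟩
      have hB1 : B.trace = 0 := by simpa using hB0 1 rfl
      have hspan : ∀ C ∈ basisAlgebra (E k),
          (Cᴴ * X).trace = star C.trace * ((d : ℂ)⁻¹ * X.trace) := by
        intro C hC
        induction hC using Submodule.span_induction with
        | mem C hC =>
          obtain ⟨j, rfl⟩ := hC
          rw [conjTranspose_proj, hX, trace_proj, star_one, one_mul]
        | zero => simp
        | add C D _ _ hC hD => simp [add_mul, hC, hD]
        | smul c C _ hC => simp [hC, mul_assoc]
      rintro _ rfl
      rw [trace_conjTranspose_mul_eq_zero_comm, hspan B hB, hB1, star_zero, zero_mul]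
    exact (trace_conjTranspose_mul_eq_zero_comm _ _).2 (hle hA X rfl)

lemma conjTranspose_mem_hsOrthogonal_tracelessSum {E : Fin n → ONB d}
    {X : Matrix (Fin d) (Fin d) ℂ}
    (hX : X ∈ hsOrthogonal (tracelessSum E : Set (Matrix (Fin d) (Fin d) ℂ))) :
    Xᴴ ∈ hsOrthogonal (tracelessSum E : Set (Matrix (Fin d) (Fin d) ℂ)) := by
  rw [mem_hsOrthogonal_tracelessSum] at hX ⊢
  intro k j
  rw [← conjTranspose_proj, ← conjTranspose_mul, trace_conjTranspose, trace_mul_comm, hX,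
    trace_conjTranspose]
  simp

lemma one_mem_hsOrthogonal_tracelessSum (E : Fin n → ONB d) :
    1 ∈ hsOrthogonal (tracelessSum E : Set (Matrix (Fin d) (Fin d) ℂ)) := by
  rw [mem_hsOrthogonal_tracelessSum]
  intro k j
  have hd : (d : ℂ) ≠ 0 := by exact_mod_cast j.pos.ne'
  simp [trace_proj, hd]

/-! ### The residual map -/

/-- The map `X ↦ X + Tr(X) 1 - ∑ Tr(P X) P`, the sum running over all projections of the bases. For
`d` mutually unbiased bases this is the orthogonal projection onto the complement of their
traceless parts. -/
noncomputable def residual (E : Fin n → ONB d) :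
    Matrix (Fin d) (Fin d) ℂ →ₗ[ℂ] Matrix (Fin d) (Fin d) ℂ where
  toFun X := X + X.trace • 1 - ∑ k, ∑ j, (proj (E k) j * X).trace • proj (E k) j
  map_add' X Y := by
    simp only [mul_add, trace_add, add_smul, Finset.sum_add_distrib]
    abel
  map_smul' c X := by
    simp only [mul_smul_comm, trace_smul, smul_eq_mul, mul_smul, ← Finset.smul_sum, smul_add,
      smul_sub, RingHom.id_apply]

lemma residual_apply (E : Fin n → ONB d) (X : Matrix (Fin d) (Fin d) ℂ) :
    residual E X = X + X.trace • 1 - ∑ k, ∑ j, (proj (E k) j * X).trace • proj (E k) j := rfl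

lemma residual_single (E : Fin n → ONB d) (p q : Fin d) (c : ℂ) :
    residual E (Matrix.single p q c) = c • residual E (Matrix.single p q 1) := by
  rw [← map_smul, Matrix.smul_single, smul_eq_mul, mul_one]

/-- The kernel of `residual` in the basis of matrix units. -/
noncomputable def residualKernel (E : Fin n → ONB d) (a b c e : Fin d) : ℂ :=
  residual E (Matrix.single c e 1) a b

lemma residualKernel_eq (E : Fin n → ONB d) (a b c e : Fin d) :
    residualKernel E a b c e =
      (if a = c then 1 else 0) * (if b = e then 1 else 0) +
      (if c = e then 1 else 0) * (if a = b then 1 else 0) -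
      ∑ k, ∑ j, (E k j).ofLp e * star ((E k j).ofLp c) *
        ((E k j).ofLp a * star ((E k j).ofLp b)) := by
  have ht : (Matrix.single c e (1 : ℂ)).trace = if c = e then 1 else 0 := by
    split_ifs with h
    · subst h; simp
    · exact trace_single_eq_of_ne _ _ _ h
  rw [residualKernel, residual_apply, ht]
  simp only [Matrix.sub_apply, Matrix.add_apply, Matrix.smul_apply, Matrix.sum_apply,
    trace_mul_single, proj_apply, smul_eq_mul, Matrix.one_apply, Matrix.single_apply]
  congr 2
  · simp only [eq_comm (a := c), eq_comm (a := e), ← ite_and, mul_ite, mul_one, mul_zero]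
    split_ifs <;> simp_all
  · simp

/-- Exchanging `a` and `e` interchanges the identity term and the trace term, and fixes each rank
one term because products of coordinates commute. -/
lemma residualKernel_swap_fst (E : Fin n → ONB d) (a b c e : Fin d) :
    residualKernel E a b c e = residualKernel E e b c a := by
  simp only [residualKernel_eq, eq_comm (a := e) (b := c), eq_comm (a := e) (b := b),
    eq_comm (a := b) (b := a), eq_comm (a := c) (b := a)]
  congr 1
  · ring
  · exact Finset.sum_congr rfl fun k _ => Finset.sum_congr rfl fun j _ => by ring

/-- The map is self-adjoint for the Hilbert-Schmidt product. -/
lemma star_residualKernel (E : Fin n → ONB d) (a b c e : Fin d) :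
    star (residualKernel E a b c e) = residualKernel E c e a b := by
  simp only [residualKernel_eq, star_sub, star_add, star_mul', star_sum, star_star,
    apply_ite star, star_one, star_zero, eq_comm (a := c) (b := a),
    eq_comm (a := e) (b := b)]
  congr 1
  · ring
  · exact Finset.sum_congr rfl fun k _ => Finset.sum_congr rfl fun j _ => by ring

/-- Exchanging the middle indices turns the matrix of the map into its Choi matrix, so the two
coincide. -/
lemma residualKernel_swap_snd (E : Fin n → ONB d) (a b c e : Fin d) :
    residualKernel E a b c e = residualKernel E a c b e := by
  rw [← star_residualKernel, residualKernel_swap_fst, star_residualKernel]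

lemma residual_entry (E : Fin n → ONB d) (X : Matrix (Fin d) (Fin d) ℂ) (a b : Fin d) :
    residual E X a b = ∑ c, ∑ e, residualKernel E a b c e * X c e := by
  conv_lhs => rw [matrix_eq_sum_single X]
  simp only [map_sum, Matrix.sum_apply]
  refine Finset.sum_congr rfl fun c _ => Finset.sum_congr rfl fun e _ => ?_
  rw [residual_single, Matrix.smul_apply, residualKernel, smul_eq_mul, mul_comm]

/-! ### With exactly `d` bases, the complement is its own commutant -/

section Complete

variable {E : Fin d → ONB d}

lemma trace_residual (X : Matrix (Fin d) (Fin d) ℂ) : (residual E X).trace = X.trace := by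
  simp only [residual_apply, trace_sub, trace_add, trace_smul, trace_one, trace_sum, trace_proj,
    smul_eq_mul, mul_one, sum_trace_proj_mul]
  simp [mul_comm]

lemma residual_mem (hE : IsMUB E) (X : Matrix (Fin d) (Fin d) ℂ) :
    residual E X ∈ hsOrthogonal (tracelessSum E : Set (Matrix (Fin d) (Fin d) ℂ)) := by
  rw [mem_hsOrthogonal_tracelessSum]
  intro m l
  have hd : (d : ℂ) ≠ 0 := by exact_mod_cast l.pos.ne'
  -- Basis `m` returns Tr(PX); each of the `d - 1` others contributes Tr(X)/d. What remains of Tr(X)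
  -- is Tr(X)/d.
  have hk : ∀ k, ∑ j, (proj (E k) j * X).trace * (proj (E m) l * proj (E k) j).trace =
      (if k = m then (proj (E m) l * X).trace - (d : ℂ)⁻¹ * X.trace else 0) +
        (d : ℂ)⁻¹ * X.trace := by
    intro k
    split_ifs with h
    · subst h
      simp [trace_proj_mul_proj_self]
    · simp only [(hE (Ne.symm h)).trace, ← Finset.sum_mul, sum_trace_proj_mul, zero_add,
        mul_comm]
  rw [trace_residual, residual_apply, mul_sub, mul_add, trace_sub, trace_add, mul_smul_comm,
    mul_one, trace_smul, trace_proj, Finset.mul_sum, trace_sum]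
  simp only [Finset.mul_sum, trace_sum, mul_smul_comm, trace_smul, smul_eq_mul, hk,
    Finset.sum_add_distrib, Finset.sum_ite_eq', Finset.mem_univ, if_true, Finset.sum_const,
    Finset.card_univ, Fintype.card_fin, nsmul_eq_mul]
  field_simp
  ring

/-- Each basis contributes (Tr(X)/d) 1 to the sum, so `d` of them cancel Tr(X) 1. -/
lemma residual_eq_self {X : Matrix (Fin d) (Fin d) ℂ}
    (hX : X ∈ hsOrthogonal (tracelessSum E : Set (Matrix (Fin d) (Fin d) ℂ))) :
    residual E X = X := by
  rw [mem_hsOrthogonal_tracelessSum] at hX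
  rcases Nat.eq_zero_or_pos d with rfl | hd
  · exact Subsingleton.elim _ _
  · have hd : (d : ℂ) ≠ 0 := by exact_mod_cast hd.ne'
    simp only [residual_apply, hX, ← Finset.smul_sum, sum_proj]
    simp only [Finset.sum_const, Finset.card_univ, Fintype.card_fin, ← Nat.cast_smul_eq_nsmul ℂ,
      smul_smul]
    rw [mul_right_comm, inv_mul_cancel₀ hd, one_mul, add_sub_cancel_right]

/-- The projection onto the complement is a completely positive map whose Kraus operators lie in
the complement. -/
lemma residual_kraus (hE : IsMUB E) (X : Matrix (Fin d) (Fin d) ℂ) :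
    residual E X = ∑ p, ∑ q, residual E (Matrix.single p q 1) * X *
      (residual E (Matrix.single p q 1))ᴴ := by
  -- Idempotence of the projection, written for kernels.
  have hidem : ∀ a b c e, ∑ p, ∑ q, residualKernel E a b p q * residualKernel E p q c e =
      residualKernel E a b c e := by
    intro a b c e
    have h := congrFun (congrFun (residual_eq_self (residual_mem hE (Matrix.single c e 1))) a) b
    rwa [residual_entry] at h
  have hswap : ∀ f : Fin d → Fin d → Fin d → Fin d → ℂ,
      ∑ c, ∑ b, ∑ p, ∑ q, f c b p q = ∑ p, ∑ q, ∑ c, ∑ b, f c b p q := by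
    intro f
    have h := Finset.sum_comm (s := Finset.univ) (t := Finset.univ)
      (f := fun x y : Fin d × Fin d => f x.1 x.2 y.1 y.2)
    simpa only [Fintype.sum_prod_type] using h
  ext a e
  have hterm : ∀ p q, (residual E (Matrix.single p q 1) * X *
      (residual E (Matrix.single p q 1))ᴴ) a e = ∑ c, ∑ b,
        X b c * (residualKernel E a b p q * residualKernel E p q e c) := by
    intro p q
    rw [Matrix.mul_apply]
    refine Finset.sum_congr rfl fun c _ => ?_
    rw [Matrix.mul_apply, Finset.sum_mul]
    refine Finset.sum_congr rfl fun b _ => ?_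
    rw [conjTranspose_apply, ← star_residualKernel E e c p q]
    simp only [residualKernel]
    ring
  simp only [Matrix.sum_apply, hterm]
  calc residual E X a e = ∑ b, ∑ c, residualKernel E a e b c * X b c := residual_entry _ _ _ _
    _ = ∑ c, ∑ b, X b c * ∑ p, ∑ q, residualKernel E a b p q * residualKernel E p q e c := by
      rw [Finset.sum_comm]
      refine Finset.sum_congr rfl fun c _ => Finset.sum_congr rfl fun b _ => ?_
      rw [hidem, residualKernel_swap_snd, mul_comm]
    _ = ∑ p, ∑ q, ∑ c, ∑ b,
        X b c * (residualKernel E a b p q * residualKernel E p q e c) := by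
      simp only [Finset.mul_sum]
      exact hswap fun c b p q =>
        X b c * (residualKernel E a b p q * residualKernel E p q e c)

lemma sum_residual_mul_conjTranspose (hE : IsMUB E) :
    ∑ p, ∑ q, residual E (Matrix.single p q 1) * (residual E (Matrix.single p q 1))ᴴ = 1 := by
  have h := residual_kraus hE 1
  rw [residual_eq_self (one_mem_hsOrthogonal_tracelessSum E)] at h
  simpa using h.symm

open scoped ComplexOrder in
/-- Fixed points of the residual map commute with its Kraus operators. -/
lemma commute_residual_single (hE : IsMUB E) {X : Matrix (Fin d) (Fin d) ℂ}
    (hX : X ∈ hsOrthogonal (tracelessSum E : Set (Matrix (Fin d) (Fin d) ℂ))) (p q : Fin d) :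
    residual E (Matrix.single p q 1) * X = X * residual E (Matrix.single p q 1) := by
  set A : Fin d × Fin d → Matrix (Fin d) (Fin d) ℂ := fun i =>
    residual E (Matrix.single i.1 i.2 1) with hA
  have hkraus : ∀ Y, ∑ i, A i * Y * (A i)ᴴ = residual E Y := by
    intro Y
    rw [residual_kraus hE, Fintype.sum_prod_type]
  have hone : ∑ i, A i * (A i)ᴴ = 1 := by
    rw [← sum_residual_mul_conjTranspose hE, Fintype.sum_prod_type]
  have hexp : ∀ i, ((A i * X - X * A i) * (A i * X - X * A i)ᴴ).trace =
      (A i * (X * Xᴴ) * (A i)ᴴ).trace - (A i * X * (A i)ᴴ * Xᴴ).trace -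
      (X * (A i * Xᴴ * (A i)ᴴ)).trace + (X * (A i * (A i)ᴴ) * Xᴴ).trace := by
    intro i
    rw [← trace_sub, ← trace_sub, ← trace_add]
    congr 1
    rw [conjTranspose_sub, conjTranspose_mul, conjTranspose_mul]
    noncomm_ring
  -- The squared norms of the commutators add up to four terms ±Tr(XX^*), two of each sign.
  have hsum : ∑ i, ((A i * X - X * A i) * (A i * X - X * A i)ᴴ).trace = 0 := by
    simp only [hexp, Finset.sum_add_distrib, Finset.sum_sub_distrib, ← trace_sum,
      ← Finset.sum_mul, ← Finset.mul_sum, hkraus, hone, trace_residual, residual_eq_self hX,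
      residual_eq_self (conjTranspose_mem_hsOrthogonal_tracelessSum hX), mul_one]
    ring
  have hzero := (Finset.sum_eq_zero_iff_of_nonneg fun i _ =>
    (posSemidef_self_mul_conjTranspose (A i * X - X * A i)).trace_nonneg).1 hsum (p, q)
      (Finset.mem_univ _)
  exact sub_eq_zero.1 (trace_mul_conjTranspose_self_eq_zero_iff.1 hzero)

/-- The complement is its own commutant. -/
lemma mem_hsOrthogonal_tracelessSum_iff_commute (hE : IsMUB E) (X : Matrix (Fin d) (Fin d) ℂ) :
    X ∈ hsOrthogonal (tracelessSum E : Set (Matrix (Fin d) (Fin d) ℂ)) ↔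
      ∀ Y ∈ hsOrthogonal (tracelessSum E : Set (Matrix (Fin d) (Fin d) ℂ)), Y * X = X * Y := by
  constructor
  · intro hX Y hY
    rw [← residual_eq_self hY, matrix_eq_sum_single Y]
    simp only [map_sum, Finset.sum_mul, Finset.mul_sum]
    refine Finset.sum_congr rfl fun p _ => Finset.sum_congr rfl fun q _ => ?_
    rw [residual_single, smul_mul_assoc, mul_smul_comm, commute_residual_single hE hX]
  · intro hX
    have h := residual_mem hE X
    rw [residual_kraus hE] at h
    -- `X` moves out past the Kraus operators, and ∑ AA^* = 1 leaves R(X) = X.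
    simp only [hX _ (residual_mem hE _), mul_assoc, ← Finset.mul_sum,
      sum_residual_mul_conjTranspose hE, mul_one] at h
    exact h

lemma isMASA_hsOrthogonal_tracelessSum (hE : IsMUB E) :
    IsMASA (hsOrthogonal (tracelessSum E : Set (Matrix (Fin d) (Fin d) ℂ))) := by
  have hcomm := mem_hsOrthogonal_tracelessSum_iff_commute hE
  let A : StarSubalgebra ℂ (Matrix (Fin d) (Fin d) ℂ) :=
    { carrier := hsOrthogonal (tracelessSum E : Set (Matrix (Fin d) (Fin d) ℂ))
      mul_mem' := fun {X Y} hX hY => (hcomm _).2 fun Z hZ => by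
        rw [← mul_assoc, (hcomm X).1 hX Z hZ, mul_assoc, (hcomm Y).1 hY Z hZ, mul_assoc]
      add_mem' := fun hX hY => Submodule.add_mem _ hX hY
      algebraMap_mem' := fun c => by
        rw [Algebra.algebraMap_eq_smul_one]
        exact Submodule.smul_mem _ _ (one_mem_hsOrthogonal_tracelessSum E)
      star_mem' := fun hX => conjTranspose_mem_hsOrthogonal_tracelessSum hX }
  refine ⟨A, rfl, fun X hX Y hY => (hcomm Y).1 hY X hX, fun C hC hAC X hX => ?_⟩
  exact (hcomm X).2 fun Y hY => hC Y (hAC hY) X hX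

end Complete

/-! ### Simultaneous diagonalisation -/

/-- Commuting Hermitian matrices have a common orthonormal eigenbasis. -/
lemma exists_orthonormalBasis_eigenvectors (S : Set (Matrix (Fin d) (Fin d) ℂ))
    (hS : ∀ A ∈ S, A.IsHermitian) (hc : ∀ A ∈ S, ∀ B ∈ S, A * B = B * A) :
    ∃ F : ONB d, ∀ A ∈ S, ∀ j, ∃ c : ℂ, A *ᵥ (F j).ofLp = c • (F j).ofLp := by
  classical
  let T : S → Module.End ℂ (EuclideanSpace ℂ (Fin d)) := fun A => toEuclideanLin A.1
  have hT : ∀ A, (T A).IsSymmetric := fun A => isSymmetric_toEuclideanLin_iff.2 (hS A.1 A.2)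
  have hC : Pairwise (Function.onFun Commute T) := by
    intro A B _
    refine LinearMap.ext fun x => ?_
    have h := congrArg (fun M => M *ᵥ x.ofLp) (hc A.1 A.2 B.1 B.2)
    simp only [← mulVec_mulVec] at h
    exact congrArg (WithLp.toLp 2) h
  let V : (S → ℂ) → Submodule ℂ (EuclideanSpace ℂ (Fin d)) := fun χ =>
    ⨅ A, Module.End.eigenspace (T A) (χ A)
  have hint : DirectSum.IsInternal V :=
    LinearMap.IsSymmetric.directSum_isInternal_of_pairwise_commute hT hC
  have hV : OrthogonalFamily ℂ (fun χ => V χ) fun χ => (V χ).subtypeₗᵢ :=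
    LinearMap.IsSymmetric.orthogonalFamily_iInf_eigenspaces hT
  -- There are infinitely many candidate joint eigenvalues `χ`; only the nonzero joint eigenspaces
  -- are kept.
  have : Finite {χ // V χ ≠ ⊥} :=
    WellFoundedGT.finite_ne_bot_of_iSupIndep hint.submodule_iSupIndep
  have : Fintype {χ // V χ ≠ ⊥} := Fintype.ofFinite _
  have hint' := DirectSum.isInternal_ne_bot_iff.2 hint
  have hV' := hV.comp (Subtype.val_injective (p := fun χ => V χ ≠ ⊥))
  have hn : Module.finrank ℂ (EuclideanSpace ℂ (Fin d)) = d := by simp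
  refine ⟨hint'.subordinateOrthonormalBasis hn hV', fun A hA j => ?_⟩
  have h := hint'.subordinateOrthonormalBasis_subordinate hn j hV'
  have h2 := (Submodule.mem_iInf _).1 h ⟨A, hA⟩
  exact ⟨_, congrArg WithLp.ofLp (Module.End.mem_eigenspace_iff.1 h2)⟩

/-- A commuting `*`-closed linear space of matrices commutes with the projections of some
orthonormal basis. -/
lemma exists_proj_commute (W : Submodule ℂ (Matrix (Fin d) (Fin d) ℂ))
    (hstar : ∀ A ∈ W, Aᴴ ∈ W) (hc : ∀ A ∈ W, ∀ B ∈ W, A * B = B * A) :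
    ∃ F : ONB d, ∀ A ∈ W, ∀ j, A * proj F j = proj F j * A := by
  obtain ⟨F, hF⟩ := exists_orthonormalBasis_eigenvectors {A | A ∈ W ∧ A.IsHermitian}
    (fun A hA => hA.2) (fun A hA B hB => hc A hA.1 B hB.1)
  have hherm : ∀ A ∈ W, A.IsHermitian → ∀ j, A * proj F j = proj F j * A := by
    intro A hA hAh j
    obtain ⟨c, hcj⟩ := hF A ⟨hA, hAh⟩ j
    have h1 : A * proj F j = c • proj F j := by
      rw [proj, mul_vecMulVec, hcj, smul_vecMulVec]
    have h2 : proj F j * A = star c • proj F j := by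
      have h := congrArg conjTranspose h1
      rwa [conjTranspose_mul, conjTranspose_smul, conjTranspose_proj, hAh.eq] at h
    have h3 : c = star c := by
      have h := trace_mul_comm A (proj F j)
      rwa [h1, h2, trace_smul, trace_smul, trace_proj, smul_eq_mul, smul_eq_mul, mul_one,
        mul_one] at h
    rw [h1, h2, ← h3]
  refine ⟨F, fun A hA j => ?_⟩
  have h1 := hherm (A + Aᴴ) (W.add_mem hA (hstar A hA)) (isHermitian_add_transpose_self A) j
  have h2 := hherm (Complex.I • (A - Aᴴ)) (W.smul_mem _ (W.sub_mem hA (hstar A hA)))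
    (by simp [IsHermitian, ← smul_neg]) j
  have h3 : A = (2⁻¹ : ℂ) • (A + Aᴴ) - (2⁻¹ * Complex.I) • (Complex.I • (A - Aᴴ)) := by
    rw [smul_smul, mul_assoc, Complex.I_mul_I]
    module
  rw [h3, sub_mul, mul_sub, smul_mul_assoc, mul_smul_comm, h1, smul_mul_assoc, mul_smul_comm, h2]

/-! ### Completing collections of bases -/

/-- A collection of `d` mutually unbiased bases in dimension `d` extends by one more basis. -/
lemma IsMUB.exists_isMUB_snoc {E : Fin d → ONB d} (hE : IsMUB E) :
    ∃ F : ONB d, IsMUB (Fin.snoc (α := fun _ => ONB d) E F : Fin (d + 1) → ONB d) := by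
  have hcomm := mem_hsOrthogonal_tracelessSum_iff_commute hE
  obtain ⟨F, hF⟩ := exists_proj_commute _
    (fun A hA => conjTranspose_mem_hsOrthogonal_tracelessSum hA)
    (fun A hA B hB => (hcomm B).1 hB A hA)
  have hEF : ∀ k, MutuallyUnbiased (E k) F := fun k => mutuallyUnbiased_of_trace fun j l => by
    -- Commuting with V^⊥ puts the projection in V^⊥, where every expectation is Tr/d.
    have h := (mem_hsOrthogonal_tracelessSum E _).1 ((hcomm (proj F l)).2 fun A hA => hF A hA l)
    rw [h, trace_proj, mul_one]
  refine ⟨F, fun a b hab => ?_⟩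
  induction a using Fin.lastCases with
  | last =>
    induction b using Fin.lastCases with
    | last => exact absurd rfl hab
    | cast b => simpa using (hEF b).symm
  | cast a =>
    induction b using Fin.lastCases with
    | last => simpa using hEF a
    | cast b => simpa using hE fun h => hab (congrArg Fin.castSucc h)

lemma IsMUB.comp {m : ℕ} {E : Fin n → ONB d} (hE : IsMUB E) {f : Fin m → Fin n}
    (hf : Function.Injective f) : IsMUB (E ∘ f) :=
  fun _ _ hab => hE (hf.ne hab)

lemma IsMUB.le_maxMUB {E : Fin n → ONB d} (hE : IsMUB E) : (n : ℕ∞) ≤ maxMUB d :=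
  le_iSup₂ (f := fun (n : ℕ) (_ : n ∈ {n : ℕ | ∃ E : Fin n → ONB d, IsMUB E}) => (n : ℕ∞)) n ⟨E, hE⟩

/-- In dimension `d > 1` there are at most `d + 1` mutually unbiased bases. -/
lemma IsMUB.card_le (hd : 1 < d) {E : Fin n → ONB d} (hE : IsMUB E) : n ≤ d + 1 := by
  by_contra! hn
  have hle : d ≤ n := by omega
  have hE' : IsMUB (E ∘ Fin.castLE hle) := hE.comp (Fin.castLE_injective hle)
  have hcomm := mem_hsOrthogonal_tracelessSum_iff_commute hE'
  have hmem : ∀ m : Fin n, d ≤ m → ∀ l, proj (E m) l ∈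
      hsOrthogonal (tracelessSum (E ∘ Fin.castLE hle) : Set (Matrix (Fin d) (Fin d) ℂ)) := by
    intro m hm l
    rw [mem_hsOrthogonal_tracelessSum]
    intro k j
    have hne : Fin.castLE hle k ≠ m := by
      intro h
      have := congrArg Fin.val h
      simp only [Fin.val_castLE] at this
      omega
    rw [trace_proj, mul_one]
    exact (hE hne).trace j l
  let a : Fin n := ⟨d, by omega⟩
  let b : Fin n := ⟨d + 1, by omega⟩
  have hab : a ≠ b := by simp [a, b]
  let i : Fin d := ⟨0, by omega⟩
  have := (hE hab).eq_one_of_commute i i ((hcomm _).1 (hmem b (by simp [b]) i) _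
    (hmem a (by simp [a]) i))
  omega

lemma maxMUB_le (hd : 1 < d) : maxMUB d ≤ ((d + 1 : ℕ) : ℕ∞) :=
  iSup₂_le fun _ ⟨_, hE⟩ => Nat.cast_le.2 (hE.card_le hd)

/-- The maximal number of mutually unbiased bases jumps from at most `d - 1` to `d + 1`. -/
lemma maxMUB_gap (d : ℕ) : ((d + 1 : ℕ) : ℕ∞) ≤ maxMUB d ∨
    (0 < d ∧ maxMUB d ≤ ((d - 1 : ℕ) : ℕ∞)) := by
  by_cases h : ∃ n, d ≤ n ∧ ∃ E : Fin n → ONB d, IsMUB E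
  · obtain ⟨n, hn, E, hE⟩ := h
    obtain ⟨F, hF⟩ := (hE.comp (Fin.castLE_injective hn)).exists_isMUB_snoc
    exact Or.inl hF.le_maxMUB
  · push Not at h
    refine Or.inr ⟨Nat.pos_of_ne_zero ?_, iSup₂_le fun n ⟨E, hE⟩ => Nat.cast_le.2 ?_⟩
    · rintro rfl
      -- For `d = 0` the empty family already has `d` members; excluding it keeps `d - 1` from
      -- truncating.
      exact h 0 le_rfl Fin.elim0 fun a => a.elim0
    · by_contra! hn
      exact h n (by omega) E hE

end MUB

theorem mainTheorem1 (d : ℕ) :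
    (∀ E : Fin d → MUB.ONB d, MUB.IsMUB E →
      MUB.IsMASA (MUB.hsOrthogonal (MUB.tracelessSum E : Set (Matrix (Fin d) (Fin d) ℂ))) ∧
      ∃ F : MUB.ONB d,
        MUB.IsCompleteMUB (Fin.snoc (α := fun _ => MUB.ONB d) E F : Fin (d + 1) → MUB.ONB d)) ∧
    MUB.maxMUB d ≠ (d : ℕ∞) ∧
    (1 < d → MUB.maxMUB d = ((d + 1 : ℕ) : ℕ∞) ∨ MUB.maxMUB d ≤ ((d - 1 : ℕ) : ℕ∞)) := by
  refine ⟨fun E hE => ⟨MUB.isMASA_hsOrthogonal_tracelessSum hE, ?_⟩, fun h => ?_, fun hd => ?_⟩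
  · obtain ⟨F, hF⟩ := hE.exists_isMUB_snoc
    exact ⟨F, rfl, hF⟩
  · rcases MUB.maxMUB_gap d with h1 | ⟨hd, h1⟩ <;>
      · rw [h, Nat.cast_le] at h1
        omega
  · exact (MUB.maxMUB_gap d).imp (fun h => le_antisymm (MUB.maxMUB_le hd) h) (fun h => h.2)
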